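/- All graphs are finite, simple and undirected; the eigenvalues of a graph are those of its adjacency matrix. For a finite set $V$, a coherent algebra on $V$ is a subalgebra $\mathcal A$ of $\operatorname{Mat}_V(\mathbb C)$ that contains the identity matrix $I$ and the all-ones matrix $J$ and is closed under transposition, under the ordinary matrix product and under the entrywise product. Every coherent algebra has a unique basis of $\{0,1\}$-matrices $A_1,\dots,A_r$ with $A_1+\dots+A_r=J$; these are the matrices of the relations of a coherent configuration on $V$, and the number $r$ of relations is called the rank of $\mathcal A$. The coherent closure of a graph $\Gamma$ with vertex set $V$ is the smallest coherent algebra on $V$ that contains the adjacency matrix of $\Gamma$, and the coherent rank of $\Gamma$ is the rank of its coherent closure. **Theorem.** Let $\Gamma$ be a connected graph with exactly three distinct eigenvalues. Then the coherent rank of $\Gamma$ is not $7$. -/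

import Mathlib

/-- The 0-1 matrix of a binary relation `R` on `V`, given as a set of ordered pairs. -/
noncomputable def relationMatrix {V : Type*} (R : Set (V × V)) : Matrix V V ℂ :=
  Matrix.of fun x y => R.indicator (fun _ => (1 : ℂ)) (x, y)

/-- The all-ones matrix `J`. -/
def allOnes (V : Type*) : Matrix V V ℂ :=
  Matrix.of fun _ _ => 1

/-- A coherent configuration on the finite point-set `V`: a finite set of nonempty binary relations
on `V` whose 0-1 matrices satisfy the four axioms (CC1)-(CC4). -/
structure CoherentConfiguration (V : Type*) [Fintype V] [DecidableEq V] where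
  /-- the relations -/
  relations : Finset (Set (V × V))
  nonempty_of_mem : ∀ R ∈ relations, R.Nonempty
  /-- (CC1) the matrices of the relations sum to `J` -/
  sum_eq_allOnes : ∑ R ∈ relations, relationMatrix R = allOnes V
  /-- (CC2) closure under transposition -/
  exists_transpose : ∀ R ∈ relations, ∃ S ∈ relations,
    (relationMatrix R).transpose = relationMatrix S
  /-- (CC3) the identity is the sum of the matrices of some of the relations -/
  exists_diagonal : ∃ Δ ⊆ relations, ∑ R ∈ Δ, relationMatrix R = 1
  /-- (CC4) existence of structure constants -/
  exists_structure_constants : ∀ R ∈ relations, ∀ S ∈ relations, ∃ p : Set (V × V) → ℂ,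
    relationMatrix R * relationMatrix S = ∑ T ∈ relations, p T • relationMatrix T

/-- The rank of a coherent configuration is its number of relations. -/
def CoherentConfiguration.rank {V : Type*} [Fintype V] [DecidableEq V]
    (C : CoherentConfiguration V) : ℕ :=
  C.relations.card

/-- A coherent algebra on `V`: a complex matrix algebra containing `I` and `J` and closed under
transposition and under the ordinary and the entrywise product. (That `I` belongs to it and the
closure under the ordinary product are part of being a `Subalgebra`.) -/
structure CoherentAlgebra (V : Type*) [Fintype V] [DecidableEq V] extends
    Subalgebra ℂ (Matrix V V ℂ) where
  allOnes_mem' : allOnes V ∈ carrier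
  transpose_mem' : ∀ M ∈ carrier, M.transpose ∈ carrier
  hadamard_mem' : ∀ M ∈ carrier, ∀ N ∈ carrier, M.hadamard N ∈ carrier

namespace CoherentAlgebra

variable {V : Type*} [Fintype V] [DecidableEq V]

/-- The class of `p` for the equivalence relation "all matrices of the coherent algebra have the
same entry at the two positions". -/
def cell (A : CoherentAlgebra V) (p : V × V) : Set (V × V) :=
  {q | ∀ M ∈ A.toSubalgebra, M q.1 q.2 = M p.1 p.2}

theorem mem_cell_self (A : CoherentAlgebra V) (p : V × V) : p ∈ A.cell p :=
  fun _ _ => rfl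

theorem cell_eq_of_mem (A : CoherentAlgebra V) {p q : V × V} (h : q ∈ A.cell p) :
    A.cell q = A.cell p := by
  ext r
  exact ⟨fun hr M hM => (hr M hM).trans (h M hM), fun hr M hM => (hr M hM).trans (h M hM).symm⟩

open Classical in
/-- The relations of the coherent algebra: the finite set of all its cells. -/
noncomputable def cells (A : CoherentAlgebra V) : Finset (Set (V × V)) :=
  Finset.univ.image A.cell

theorem mem_cells (A : CoherentAlgebra V) {R : Set (V × V)} :
    R ∈ A.cells ↔ ∃ p, A.cell p = R := by
  classical
  simp [cells]

open Classical in
/-- Evaluation of a linear combination of the 0-1 matrices of cells. -/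
theorem sum_cells_apply (A : CoherentAlgebra V) (f : Set (V × V) → ℂ) {s : Finset (Set (V × V))}
    (hs : s ⊆ A.cells) (p : V × V) :
    (∑ R ∈ s, f R • relationMatrix R) p.1 p.2 = if A.cell p ∈ s then f (A.cell p) else 0 := by
  have h : ∀ R ∈ s, (f R • relationMatrix R) p.1 p.2 = if A.cell p = R then f R else 0 := by
    intro R hR
    obtain ⟨q, rfl⟩ := A.mem_cells.1 (hs hR)
    by_cases hp : p ∈ A.cell q
    · simp [relationMatrix, hp, A.cell_eq_of_mem hp]
    · have : A.cell p ≠ A.cell q := fun h => hp (h ▸ A.mem_cell_self p)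
      simp [relationMatrix, hp, this]
  rw [Matrix.sum_apply, Finset.sum_congr rfl h, Finset.sum_ite_eq]

/-- Every matrix of a coherent algebra is a linear combination of the 0-1 matrices of the cells. -/
theorem exists_eq_sum_cells (A : CoherentAlgebra V) {M : Matrix V V ℂ} (hM : M ∈ A.toSubalgebra) :
    ∃ f : Set (V × V) → ℂ, M = ∑ R ∈ A.cells, f R • relationMatrix R := by
  classical
  refine ⟨fun R => if h : ∃ p, A.cell p = R then M h.choose.1 h.choose.2 else 0, ?_⟩
  ext x y
  rw [A.sum_cells_apply _ subset_rfl (x, y), if_pos (A.mem_cells.2 ⟨_, rfl⟩),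
    dif_pos ⟨_, rfl⟩]
  have h : ∃ p, A.cell p = A.cell (x, y) := ⟨_, rfl⟩
  have h1 : (x, y) ∈ A.cell h.choose := by
    rw [h.choose_spec]; exact A.mem_cell_self (x, y)
  exact h1 M hM

/-- The 0-1 matrix of each cell lies in the coherent algebra. -/
theorem relationMatrix_cell_mem (A : CoherentAlgebra V) (p : V × V) :
    relationMatrix (A.cell p) ∈ A.toSubalgebra := by
  classical
  have key : ∀ s : Finset (V × V), (∀ q ∈ s, q ∉ A.cell p) →
      ∃ M ∈ A.toSubalgebra, M p.1 p.2 = 1 ∧ ∀ q ∈ s, M q.1 q.2 = 0 := by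
    intro s
    induction s using Finset.induction_on with
    | empty => exact fun _ => ⟨allOnes V, A.allOnes_mem', rfl, by simp⟩
    | insert q s _ ih =>
      intro h
      obtain ⟨M, hM, hMp, hMs⟩ := ih fun r hr => h r (Finset.mem_insert_of_mem hr)
      have hq := h q (Finset.mem_insert_self _ _)
      simp only [cell, Set.mem_ofPred_eq, not_forall] at hq
      obtain ⟨N, hN, hne⟩ := hq
      have hne' : N p.1 p.2 - N q.1 q.2 ≠ 0 := sub_ne_zero.2 fun e => hne e.symm
      refine ⟨M.hadamard ((N p.1 p.2 - N q.1 q.2)⁻¹ • (N - N q.1 q.2 • allOnes V)),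
        A.hadamard_mem' _ hM _ (A.toSubalgebra.smul_mem (A.toSubalgebra.sub_mem hN
          (A.toSubalgebra.smul_mem A.allOnes_mem' _)) _), ?_, ?_⟩
      · simp [allOnes, hMp, hne']
      · intro r hr
        rcases Finset.mem_insert.1 hr with rfl | hr
        · simp [allOnes]
        · simp [hMs r hr]
  obtain ⟨M, hM, hMp, hM0⟩ := key (Finset.univ.filter (· ∉ A.cell p)) (by simp)
  convert hM
  ext x y
  by_cases h : (x, y) ∈ A.cell p
  · rw [h M hM, hMp]
    simp [relationMatrix, h]
  · rw [hM0 (x, y) (by simpa using h)]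
    simp [relationMatrix, h]

/-- The coherent configuration that corresponds to a coherent algebra. -/
noncomputable def configuration (A : CoherentAlgebra V) : CoherentConfiguration V where
  relations := A.cells
  nonempty_of_mem R hR := by
    obtain ⟨p, rfl⟩ := A.mem_cells.1 hR
    exact ⟨p, A.mem_cell_self p⟩
  sum_eq_allOnes := by
    classical
    have h := A.sum_cells_apply (fun _ => 1) subset_rfl
    ext x y
    simpa [allOnes, A.mem_cells] using h (x, y)
  exists_transpose R hR := by
    obtain ⟨p, rfl⟩ := A.mem_cells.1 hR
    refine ⟨A.cell p.swap, A.mem_cells.2 ⟨_, rfl⟩, ?_⟩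
    have h : ∀ x y : V, (y, x) ∈ A.cell p ↔ (x, y) ∈ A.cell p.swap := fun x y =>
      ⟨fun h M hM => h M.transpose (A.transpose_mem' M hM),
        fun h M hM => h M.transpose (A.transpose_mem' M hM)⟩
    ext x y
    by_cases hp : (y, x) ∈ A.cell p
    · simp [relationMatrix, hp, (h x y).1 hp]
    · simp [relationMatrix, hp, mt (h x y).2 hp]
  exists_diagonal := by
    classical
    have hs : Finset.univ.image (fun x : V => A.cell (x, x)) ⊆ A.cells := by
      intro R hR
      obtain ⟨x, _, rfl⟩ := Finset.mem_image.1 hR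
      exact A.mem_cells.2 ⟨_, rfl⟩
    refine ⟨_, hs, ?_⟩
    ext x y
    have h := A.sum_cells_apply (fun _ => 1) hs (x, y)
    simp only [one_smul] at h
    rw [h]
    by_cases hxy : x = y
    · subst hxy
      simp
    · rw [if_neg, Matrix.one_apply_ne hxy]
      intro hmem
      obtain ⟨z, _, hz⟩ := Finset.mem_image.1 hmem
      have h1 : (x, y) ∈ A.cell (z, z) := hz ▸ A.mem_cell_self (x, y)
      have h2 := h1 1 A.toSubalgebra.one_mem
      simp [Matrix.one_apply_ne hxy] at h2
  exists_structure_constants R hR S hS := by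
    obtain ⟨p, rfl⟩ := A.mem_cells.1 hR
    obtain ⟨q, rfl⟩ := A.mem_cells.1 hS
    exact A.exists_eq_sum_cells
      (A.toSubalgebra.mul_mem (A.relationMatrix_cell_mem p) (A.relationMatrix_cell_mem q))

/-- The 0-1 matrices of the corresponding coherent configuration span the coherent algebra. -/
theorem span_configuration (A : CoherentAlgebra V) :
    Submodule.span ℂ (relationMatrix '' (A.configuration.relations : Set (Set (V × V)))) =
      Subalgebra.toSubmodule A.toSubalgebra := by
  apply le_antisymm
  · rw [Submodule.span_le]
    rintro _ ⟨R, hR, rfl⟩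
    obtain ⟨p, rfl⟩ := A.mem_cells.1 hR
    exact A.relationMatrix_cell_mem p
  · intro M hM
    obtain ⟨f, rfl⟩ := A.exists_eq_sum_cells hM
    exact Submodule.sum_mem _ fun R hR =>
      Submodule.smul_mem _ _ (Submodule.subset_span ⟨R, hR, rfl⟩)

/-- The 0-1 matrices of the corresponding coherent configuration are linearly independent. Together
with the previous fact, they form a basis of the coherent algebra. -/
theorem linearIndependent_configuration (A : CoherentAlgebra V) :
    LinearIndepOn ℂ relationMatrix (A.configuration.relations : Set (Set (V × V))) := by
  classical
  rw [linearIndepOn_finset_iff]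
  intro f hf R hR
  obtain ⟨p, rfl⟩ := A.mem_cells.1 hR
  have h := A.sum_cells_apply f subset_rfl p
  rw [if_pos (A.mem_cells.2 ⟨_, rfl⟩)] at h
  rw [← h]
  exact congrFun (congrFun hf p.1) p.2

/-- The rank of a coherent algebra is the rank of the corresponding coherent configuration. -/
noncomputable def rank (A : CoherentAlgebra V) : ℕ :=
  A.configuration.rank

end CoherentAlgebra

namespace SimpleGraph

variable {V : Type*} [Fintype V] [DecidableEq V]

/-- The coherent closure of a graph: the intersection of all coherent algebras that contain its
adjacency matrix. -/
def coherentClosure (G : SimpleGraph V) [DecidableRel G.Adj] : CoherentAlgebra V where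
  carrier := {M | ∀ A : CoherentAlgebra V, G.adjMatrix ℂ ∈ A.toSubalgebra → M ∈ A.toSubalgebra}
  mul_mem' hM hN A hA := A.toSubalgebra.mul_mem (hM A hA) (hN A hA)
  add_mem' hM hN A hA := A.toSubalgebra.add_mem (hM A hA) (hN A hA)
  algebraMap_mem' c A _ := A.toSubalgebra.algebraMap_mem c
  allOnes_mem' A _ := A.allOnes_mem'
  transpose_mem' M hM A hA := A.transpose_mem' M (hM A hA)
  hadamard_mem' M hM N hN A hA := A.hadamard_mem' M (hM A hA) N (hN A hA)

theorem adjMatrix_mem_coherentClosure (G : SimpleGraph V) [DecidableRel G.Adj] :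
    G.adjMatrix ℂ ∈ G.coherentClosure.toSubalgebra :=
  fun _ hA => hA

theorem coherentClosure_le (G : SimpleGraph V) [DecidableRel G.Adj] (A : CoherentAlgebra V)
    (hA : G.adjMatrix ℂ ∈ A.toSubalgebra) : G.coherentClosure.toSubalgebra ≤ A.toSubalgebra :=
  fun _ hM => hM A hA

/-- The coherent rank of a graph is the rank of its coherent closure. -/
noncomputable def coherentRank (G : SimpleGraph V) [DecidableRel G.Adj] : ℕ :=
  G.coherentClosure.rank

/-- The set of (distinct) eigenvalues of a graph, that is, of its adjacency matrix. This matrix is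
real symmetric, so that all its eigenvalues are real. -/
def eigenvalueSet (G : SimpleGraph V) [DecidableRel G.Adj] : Set ℝ :=
  {μ | Module.End.HasEigenvalue (Matrix.toLin' (G.adjMatrix ℝ)) μ}

end SimpleGraph

/-! For a connected graph with three eigenvalues, Perron–Frobenius gives `A² = sA + tI + ααᵀ` with a
positive eigenvector `α`. Reading the diagonal, `deg x = t + α(x)²`, so `α` is a function of the
degree.

The rank is compared with the number of pair types: the two degrees together with the information
"equal" and "adjacent". Each is determined by the cell, so there are at most as many pair types as
relations. If vertices of different degrees are always adjacent, the identity shows that the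
matrices depending only on the pair type lie in a coherent algebra containing `A`, and the two
numbers agree (`coherentRank_le_card_pairTypes`).

With one degree the rank is at most 3, and with three or more degrees it is at least 9. With two
degrees, a nonadjacent pair of different degrees forces 8 pair types (`eight_le_card_pairTypes`).
Otherwise the graph is a join with 8 conceivable pair types, and exactly one missing type is
impossible (`mem_pairTypes_of_join`): it would give two dominating vertices, or a join with an
edgeless part, and counting common neighbours then makes the degrees equal. -/

open Matrix CoherentAlgebra
open Module.End (HasEigenvalue hasEigenvalue_of_hasEigenvector mem_eigenspace_iff)

/-! ### Spectra of real symmetric matrices. -/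

namespace Matrix.IsHermitian

variable {V : Type*} [Fintype V] [DecidableEq V] {A : Matrix V V ℝ}

theorem hasEigenvalue_toLin'_eigenvalues (hA : A.IsHermitian) (i : V) :
    HasEigenvalue (toLin' A) (hA.eigenvalues i) := by
  refine hasEigenvalue_of_hasEigenvector (x := WithLp.ofLp (hA.eigenvectorBasis i))
    ⟨mem_eigenspace_iff.2 ?_, ?_⟩
  · rw [toLin'_apply]; exact hA.mulVec_eigenvectorBasis i
  · intro h
    exact hA.eigenvectorBasis.orthonormal.ne_zero i ((WithLp.ofLp_eq_zero 2).1 h)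

/-- A real symmetric matrix whose eigenvalues are at most `θ` is dominated by `θ • 1`. -/
theorem posSemidef_smul_one_sub (hA : A.IsHermitian) {θ : ℝ}
    (h : ∀ μ, HasEigenvalue (toLin' A) μ → μ ≤ θ) : (θ • (1 : Matrix V V ℝ) - A).PosSemidef := by
  have hB : (θ • (1 : Matrix V V ℝ) - A).IsHermitian :=
    (isHermitian_one.smul (by simp [IsSelfAdjoint])).sub hA
  rw [hB.posSemidef_iff_eigenvalues_nonneg]
  intro i
  obtain ⟨v, hv, hv0⟩ := (hB.hasEigenvalue_toLin'_eigenvalues i).exists_hasEigenvector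
  rw [mem_eigenspace_iff, toLin'_apply, sub_mulVec, smul_mulVec, one_mulVec] at hv
  have := h (θ - hB.eigenvalues i) (hasEigenvalue_of_hasEigenvector (x := v)
    ⟨mem_eigenspace_iff.2 (by rw [toLin'_apply, sub_smul, ← hv]; abel), hv0⟩)
  simpa using this

/-- A real symmetric matrix with at most three eigenvalues is annihilated by a cubic. -/
theorem mul_mul_eq_zero (hA : A.IsHermitian) {a b c : ℝ}
    (h : ∀ μ, HasEigenvalue (toLin' A) μ → μ = a ∨ μ = b ∨ μ = c) :
    (A - a • 1) * ((A - b • 1) * (A - c • 1)) = 0 := by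
  have key : ∀ i (d : ℝ), (A - d • 1) *ᵥ (WithLp.ofLp (hA.eigenvectorBasis i)) =
      (hA.eigenvalues i - d) • (WithLp.ofLp (hA.eigenvectorBasis i)) := by
    intro i d
    rw [sub_mulVec, smul_mulVec, one_mulVec, hA.mulVec_eigenvectorBasis, sub_smul]
  apply toLin'.injective
  rw [map_zero]
  apply (hA.eigenvectorBasis.toBasis.map (WithLp.linearEquiv 2 ℝ (V → ℝ))).ext
  intro i
  simp only [Module.Basis.map_apply, OrthonormalBasis.coe_toBasis, WithLp.linearEquiv_apply,
    toLin'_apply, LinearMap.zero_apply]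
  change _ *ᵥ (WithLp.ofLp (hA.eigenvectorBasis i)) = 0
  rw [← mulVec_mulVec, ← mulVec_mulVec, key, mulVec_smul, key, mulVec_smul, mulVec_smul, key]
  rcases h _ (hA.hasEigenvalue_toLin'_eigenvalues i) with h | h | h <;> simp [h]

end Matrix.IsHermitian

/-! ### Perron–Frobenius and the quadratic identity. -/

namespace SimpleGraph

variable {V : Type*} [Fintype V] [DecidableEq V] {G : SimpleGraph V} [DecidableRel G.Adj]

/-- The form of `θI - A` is nonnegative and vanishes at `u`. Its off-diagonal entries are at most 0,
so passing to `|u|` does not increase the form; it vanishes there too, and a zero of a semidefinite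
form lies in the kernel. -/
theorem adjMatrix_mulVec_abs (θ : ℝ) (hθ : (θ • (1 : Matrix V V ℝ) - G.adjMatrix ℝ).PosSemidef)
    {u : V → ℝ} (hu : G.adjMatrix ℝ *ᵥ u = θ • u) :
    G.adjMatrix ℝ *ᵥ |u| = θ • |u| := by
  have h0 : star u ⬝ᵥ ((θ • (1 : Matrix V V ℝ) - G.adjMatrix ℝ) *ᵥ u) = 0 := by
    rw [sub_mulVec, hu]; simp [smul_mulVec]
  have h1 := hθ.dotProduct_mulVec_nonneg |u|
  have h2 : star |u| ⬝ᵥ ((θ • (1 : Matrix V V ℝ) - G.adjMatrix ℝ) *ᵥ |u|) ≤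
      star u ⬝ᵥ ((θ • (1 : Matrix V V ℝ) - G.adjMatrix ℝ) *ᵥ u) := by
    simp only [dotProduct, mulVec, star_trivial, Pi.abs_apply, Finset.mul_sum]
    refine Finset.sum_le_sum fun x _ => Finset.sum_le_sum fun y _ => ?_
    by_cases hxy : x = y
    · subst hxy
      simp only [Matrix.sub_apply, adjMatrix_apply, SimpleGraph.irrefl, if_false, sub_zero]
      rw [mul_left_comm, abs_mul_abs_self, ← mul_left_comm]
    · simp only [Matrix.sub_apply, Matrix.smul_apply, Matrix.one_apply_ne hxy, adjMatrix_apply, smul_zero]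
      split_ifs
      · have : u x * u y ≤ |u x| * |u y| := by rw [← abs_mul]; exact le_abs_self _
        linarith
      · simp
  have h3 := (hθ.dotProduct_mulVec_zero_iff |u|).1 (le_antisymm (h2.trans h0.le) h1)
  rw [sub_mulVec, smul_mulVec, one_mulVec, sub_eq_zero] at h3
  exact h3.symm

/-- An eigenvector for the largest eigenvalue of a connected graph vanishes nowhere. -/
theorem Connected.ne_zero_of_adjMatrix_mulVec (hconn : G.Connected) {θ : ℝ}
    (hθ : (θ • (1 : Matrix V V ℝ) - G.adjMatrix ℝ).PosSemidef) {u : V → ℝ}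
    (hu : G.adjMatrix ℝ *ᵥ u = θ • u) (hu0 : u ≠ 0) (x : V) : u x ≠ 0 := by
  intro hx
  have habs := adjMatrix_mulVec_abs θ hθ hu
  have step : ∀ y z, G.Adj y z → u y = 0 → u z = 0 := by
    intro y z hyz hy
    have h := congrFun habs y
    rw [adjMatrix_mulVec_apply] at h
    simp only [Pi.smul_apply, Pi.abs_apply, hy, abs_zero, smul_zero] at h
    rw [Finset.sum_eq_zero_iff_of_nonneg (fun _ _ => abs_nonneg _)] at h
    exact abs_eq_zero.1 (h z (by simpa using hyz))
  apply hu0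
  funext y
  obtain ⟨w⟩ := hconn.preconnected x y
  induction w with
  | nil => exact hx
  | cons h _ ih => exact ih (step _ _ h hx)

/-- The adjacency matrix of a connected graph with three eigenvalues satisfies a quadratic equation
up to a rank one matrix given by a positive eigenvector. -/
theorem Connected.exists_adjMatrix_mul_self_eq (hconn : G.Connected)
    (heig : G.eigenvalueSet.ncard = 3) :
    ∃ (s t θ : ℝ) (α : V → ℝ), (∀ x, 0 < α x) ∧ G.adjMatrix ℝ *ᵥ α = θ • α ∧
      G.adjMatrix ℝ * G.adjMatrix ℝ = s • G.adjMatrix ℝ + t • 1 + vecMulVec α α := by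
  obtain ⟨θ, b, c, hb, hc, hS, hmax⟩ : ∃ θ b c : ℝ, b < θ ∧ c < θ ∧
      HasEigenvalue (toLin' (G.adjMatrix ℝ)) θ ∧
      ∀ μ, HasEigenvalue (toLin' (G.adjMatrix ℝ)) μ → μ = θ ∨ μ = b ∨ μ = c := by
    obtain ⟨x, y, z, hxy, hxz, hyz, hS⟩ := Set.ncard_eq_three.1 heig
    have h : ∀ μ, HasEigenvalue (toLin' (G.adjMatrix ℝ)) μ ↔ μ = x ∨ μ = y ∨ μ = z :=
      fun μ => Set.ext_iff.1 hS μ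
    rcases lt_or_gt_of_ne hxy with h1 | h1 <;> rcases lt_or_gt_of_ne hxz with h2 | h2 <;>
      rcases lt_or_gt_of_ne hyz with h3 | h3
    all_goals first
      | exact ⟨x, y, z, by linarith, by linarith, (h _).2 (by simp), fun μ hμ => (h μ).1 hμ⟩
      | exact ⟨y, x, z, by linarith, by linarith, (h _).2 (by simp),
          fun μ hμ => by have := (h μ).1 hμ; tauto⟩
      | exact ⟨z, x, y, by linarith, by linarith, (h _).2 (by simp),
          fun μ hμ => by have := (h μ).1 hμ; tauto⟩
  set A := G.adjMatrix ℝ with hAdef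
  have hA : A.IsHermitian := by
    rw [IsHermitian, conjTranspose_eq_transpose_of_trivial, transpose_adjMatrix]
  have hpsd := hA.posSemidef_smul_one_sub (θ := θ) fun μ hμ => by
    rcases hmax μ hμ with h | h | h <;> linarith
  obtain ⟨v₀, hv₀, hv₀0⟩ := hS.exists_hasEigenvector
  rw [mem_eigenspace_iff, toLin'_apply] at hv₀
  set v := |v₀| with hvdef
  have hv : A *ᵥ v = θ • v := adjMatrix_mulVec_abs θ hpsd hv₀
  have hvpos : ∀ x, 0 < v x := fun x =>
    abs_pos.2 (hconn.ne_zero_of_adjMatrix_mulVec hpsd hv₀ hv₀0 x)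
  obtain ⟨o⟩ := hconn.nonempty
  -- Simplicity of `θ`: subtracting the multiple of `v` that agrees with `u` at `o` leaves a
  -- `θ`-eigenvector with a zero entry, hence 0.
  have huniq : ∀ u : V → ℝ, A *ᵥ u = θ • u → u = (u o / v o) • v := by
    intro u hu
    by_contra hne
    refine hconn.ne_zero_of_adjMatrix_mulVec hpsd (u := u - (u o / v o) • v) ?_
      (sub_ne_zero.2 hne) o ?_
    · rw [← hAdef, mulVec_sub, mulVec_smul, hu, hv, smul_sub, smul_comm]
    · simp [(hvpos o).ne']
  set B := (A - b • 1) * (A - c • 1) with hB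
  have hB0 := hA.mul_mul_eq_zero hmax
  rw [← hB] at hB0
  have hBexp : B = A * A - (b + c) • A + (b * c) • (1 : Matrix V V ℝ) := by
    rw [hB, sub_mul, mul_sub, mul_sub]
    simp only [smul_mul_assoc, mul_smul_comm, one_mul, mul_one, smul_smul]
    module
  have hBsymm : ∀ x y, B x y = B y x := by
    intro x y
    have : Bᵀ = B := by
      rw [hBexp]
      simp [transpose_mul, hAdef]
    rw [← this, transpose_apply, this]
  -- As `(A - θ)B = 0`, each column of `B` is a multiple of `v`; by symmetry `B` is then a multiple
  -- `κ` of `vvᵀ`.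
  have hcol : ∀ x y, B x y = B o y / v o * v x := by
    intro x y
    have := huniq (fun z => B z y) (by
      funext z
      have h := congrFun (congrFun hB0 z) y
      rw [sub_mul, smul_mul_assoc, one_mul] at h
      simp only [Matrix.sub_apply, Matrix.smul_apply, Matrix.zero_apply] at h
      exact sub_eq_zero.1 h)
    exact congrFun this x
  set κ := B o o / v o / v o with hκ
  have hBκ : ∀ x y, B x y = κ * (v x * v y) := by
    intro x y
    rw [hcol x y, hBsymm o y, hcol y o, hκ]; ring
  -- Evaluating `Bv` in two ways gives `κ(v·v) = (θ - b)(θ - c)`, which is positive because `θ` is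
  -- the largest eigenvalue.
  have hκpos : 0 < κ := by
    have h1 : B *ᵥ v = ((θ - b) * (θ - c)) • v := by
      rw [hB, ← mulVec_mulVec]
      simp only [sub_mulVec, smul_mulVec, one_mulVec, hv, ← sub_smul, mulVec_smul, smul_smul]
      congr 1; ring
    have h2 := congrFun h1 o
    simp only [mulVec, dotProduct, hBκ, Pi.smul_apply, smul_eq_mul] at h2
    have h3 : κ * (v o * ∑ y, v y * v y) = (θ - b) * (θ - c) * v o := by
      rw [← h2, Finset.mul_sum, Finset.mul_sum]
      exact Finset.sum_congr rfl fun _ _ => by ring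
    have h4 : 0 < (θ - b) * (θ - c) * v o :=
      mul_pos (mul_pos (sub_pos.2 hb) (sub_pos.2 hc)) (hvpos o)
    rw [← h3] at h4
    exact pos_of_mul_pos_left h4
      (mul_nonneg (hvpos o).le (Finset.sum_nonneg fun _ _ => mul_self_nonneg _))
  refine ⟨b + c, -(b * c), θ, √κ • v, fun x => mul_pos (Real.sqrt_pos.2 hκpos) (hvpos x), ?_, ?_⟩
  · rw [mulVec_smul, hv, smul_comm]
  · have : vecMulVec (√κ • v) (√κ • v) = B := by
      ext x y
      rw [vecMulVec_apply, hBκ]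
      simp only [Pi.smul_apply, smul_eq_mul]
      rw [mul_mul_mul_comm, Real.mul_self_sqrt hκpos.le]
    rw [this, hBexp]
    module

end SimpleGraph

/-! ### The coherent algebra of block combinations. -/

namespace CoherentAlgebra

variable {V : Type*}

/-- The matrices that combine the identity and a matrix `B` with coefficients depending on the class
`c x` of the row, plus a matrix that is constant on all products of two classes. -/
def IsBlockCombination [DecidableEq V] {ι : Type*} (c : V → ι) (B M : Matrix V V ℂ) : Prop :=
  ∃ (p q : ι → ℂ) (r : ι → ι → ℂ), ∀ x y,
    M x y = (if x = y then p (c x) else 0) + q (c x) * B x y + r (c x) (c y)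

theorem mul_comp_class_eq {ι : Type*} {c : V → ι} {B : Matrix V V ℂ}
    (hclass : ∀ x y, c x ≠ c y → B x y = 0) (f : ι → ℂ) (x y : V) :
    B x y * f (c y) = B x y * f (c x) := by
  by_cases h : c x = c y
  · rw [h]
  · rw [hclass x y h, zero_mul, zero_mul]

variable [Fintype V] [DecidableEq V]

/-- `B` commutes with diagonal matrices constant on classes, and its product with a matrix constant
on class blocks is again of that kind, since its row sums depend only on the class. The only product
left is `B * B`, covered by `hsq`. -/
theorem IsBlockCombination.mul {ι : Type*} {c : V → ι} {B M N : Matrix V V ℂ}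
    (hsymm : ∀ x y, B x y = B y x) (hclass : ∀ x y, c x ≠ c y → B x y = 0)
    {k : ι → ℂ} (hk : ∀ x, ∑ z, B x z = k (c x)) (hsq : IsBlockCombination c B (B * B))
    (hM : IsBlockCombination c B M) (hN : IsBlockCombination c B N) :
    IsBlockCombination c B (M * N) := by
  obtain ⟨p, q, r, hM⟩ := hM
  obtain ⟨p', q', r', hN⟩ := hN
  obtain ⟨u, v, w, hsq⟩ := hsq
  have hcl := mul_comp_class_eq hclass
  have hcol : ∀ y, ∑ z, B z y = k (c y) := fun y => by simp_rw [hsymm _ y, hk]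
  refine ⟨fun i => p i * p' i + q i * q' i * u i,
    fun i => p i * q' i + q i * p' i + q i * q' i * v i,
    fun i j => p i * r' i j + q i * q' i * w i j + q i * k i * r' i j + r i j * p' j +
      r i j * q' j * k j + ∑ z, r i (c z) * r' (c z) j, fun x y => ?_⟩
  have h1 : ∑ z, (if x = z then p (c x) else 0) * N z y = p (c x) * N x y := by simp
  have h2 : ∑ z, q (c x) * B x z * N z y =
      q (c x) * (p' (c x) * B x y + q' (c x) * (B * B) x y + k (c x) * r' (c x) (c y)) := by
    have e1 : ∑ z, B x z * (if z = y then p' (c z) else 0) = p' (c x) * B x y := by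
      simp [hcl p', mul_comm]
    have e2 : ∑ z, B x z * (q' (c z) * B z y) = q' (c x) * (B * B) x y := by
      simp_rw [← mul_assoc, hcl q', mul_apply, Finset.mul_sum]
      exact Finset.sum_congr rfl fun _ _ => by ring
    have e3 : ∑ z, B x z * r' (c z) (c y) = k (c x) * r' (c x) (c y) := by
      simp_rw [hcl (fun i => r' i (c y)), ← Finset.sum_mul, hk]
    rw [← e1, ← e2, ← e3, ← Finset.sum_add_distrib, ← Finset.sum_add_distrib, Finset.mul_sum]
    exact Finset.sum_congr rfl fun z _ => by rw [hN]; ring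
  have h3 : ∑ z, r (c x) (c z) * N z y = r (c x) (c y) * p' (c y) +
      r (c x) (c y) * q' (c y) * k (c y) + ∑ z, r (c x) (c z) * r' (c z) (c y) := by
    have e1 : ∑ z, r (c x) (c z) * (if z = y then p' (c z) else 0) =
        r (c x) (c y) * p' (c y) := by simp
    have e2 : ∑ z, r (c x) (c z) * (q' (c z) * B z y) = r (c x) (c y) * q' (c y) * k (c y) := by
      rw [← hcol, Finset.mul_sum]
      refine Finset.sum_congr rfl fun z _ => ?_
      have := hcl (fun i => r (c x) i * q' i) y z
      rw [hsymm y z] at this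
      linear_combination this
    rw [← e1, ← e2, ← Finset.sum_add_distrib, ← Finset.sum_add_distrib]
    exact Finset.sum_congr rfl fun z _ => by rw [hN]; ring
  have h : (M * N) x y = (∑ z, (if x = z then p (c x) else 0) * N z y) +
      (∑ z, q (c x) * B x z * N z y) + ∑ z, r (c x) (c z) * N z y := by
    rw [mul_apply, ← Finset.sum_add_distrib, ← Finset.sum_add_distrib]
    exact Finset.sum_congr rfl fun z _ => by rw [hM]; ring
  rw [h, h1, h2, h3, hN, hsq]
  by_cases hxy : x = y
  · subst hxy; simp only [if_true]; ring
  · simp only [hxy, if_false]; ring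

/-- The coherent algebra of all block combinations of a 0-1 matrix `B`. -/
def ofBlockCombinations {ι : Type*} (c : V → ι) (B : Matrix V V ℂ)
    (hsymm : ∀ x y, B x y = B y x) (hidem : ∀ x y, B x y * B x y = B x y) (hdiag : ∀ x, B x x = 0)
    (hclass : ∀ x y, c x ≠ c y → B x y = 0) (k : ι → ℂ) (hk : ∀ x, ∑ z, B x z = k (c x))
    (hsq : IsBlockCombination c B (B * B)) : CoherentAlgebra V where
  carrier := {M | IsBlockCombination c B M}
  mul_mem' hM hN := IsBlockCombination.mul hsymm hclass hk hsq hM hN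
  add_mem' := by
    rintro M N ⟨p, q, r, hM⟩ ⟨p', q', r', hN⟩
    refine ⟨p + p', q + q', r + r', fun x y => ?_⟩
    rw [Matrix.add_apply, hM, hN]
    simp only [Pi.add_apply]
    split_ifs <;> ring
  algebraMap_mem' a := by
    refine ⟨fun _ => a, 0, 0, fun x y => ?_⟩
    simp [algebraMap_matrix_apply]
  allOnes_mem' := ⟨0, 0, 1, fun x y => by simp [allOnes]⟩
  transpose_mem' := by
    rintro M ⟨p, q, r, hM⟩
    refine ⟨p, q, fun i j => r j i, fun x y => ?_⟩
    rw [transpose_apply, hM, hsymm y x]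
    have := mul_comp_class_eq hclass q x y
    by_cases hxy : x = y
    · subst hxy; simp
    · simp only [hxy, Ne.symm hxy, if_false]
      linear_combination this
  hadamard_mem' := by
    rintro M ⟨p, q, r, hM⟩ N ⟨p', q', r', hN⟩
    -- No `p`–`q` cross terms occur because `B` has zero diagonal, and `B` is its own entrywise
    -- square.
    refine ⟨fun i => p i * p' i + p i * r' i i + r i i * p' i,
      fun i => q i * q' i + q i * r' i i + r i i * q' i, fun i j => r i j * r' i j, fun x y => ?_⟩
    rw [hadamard_apply, hM, hN]
    by_cases hxy : x = y
    · subst hxy; simp only [if_true, hdiag]; ring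
    · simp only [hxy, if_false]
      by_cases hc : c x = c y
      · rw [← hc]
        linear_combination q (c x) * q' (c x) * hidem x y
      · rw [hclass x y hc]; ring

end CoherentAlgebra

/-! ### Pair types against cells. -/

theorem Finset.card_image_le_of_factorsThrough {α β γ : Type*} [DecidableEq β] [DecidableEq γ]
    (s : Finset α) {f : α → β} {g : α → γ} (h : f.FactorsThrough g) :
    (s.image f).card ≤ (s.image g).card := by
  by_cases hs : s.Nonempty
  · obtain ⟨a, -⟩ := hs
    have : s.image f = (s.image g).image (Function.extend g f fun _ => f a) := by
      rw [Finset.image_image]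
      exact Finset.image_congr fun x _ => (h.extend_apply _ x).symm
    rw [this]
    exact Finset.card_image_le
  · simp [Finset.not_nonempty_iff_eq_empty.1 hs]

namespace SimpleGraph

variable {V : Type*} [Fintype V] [DecidableEq V] (G : SimpleGraph V) [DecidableRel G.Adj]

/-- The invariants of a pair of vertices that are visible in every coherent algebra containing the
adjacency matrix. -/
def pairType (p : V × V) : ℕ × ℕ × Bool × Bool :=
  (G.degree p.1, G.degree p.2, decide (p.1 = p.2), decide (G.Adj p.1 p.2))

/-- The pair types that occur. -/
def pairTypes : Finset (ℕ × ℕ × Bool × Bool) :=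
  Finset.univ.image G.pairType

variable {G}

theorem pairType_mem (x y : V) : G.pairType (x, y) ∈ G.pairTypes :=
  Finset.mem_image_of_mem _ (Finset.mem_univ _)

theorem pairType_factorsThrough_cell : G.pairType.FactorsThrough G.coherentClosure.cell := by
  intro p q h
  have hp : p ∈ G.coherentClosure.cell q := h ▸ G.coherentClosure.mem_cell_self p
  have hA := G.adjMatrix_mem_coherentClosure
  have hJ := G.coherentClosure.allOnes_mem'
  -- The degrees of the two vertices are the entries of `AJ` and `JA`.
  have h1 := hp _ (G.coherentClosure.toSubalgebra.mul_mem hA hJ)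
  have h2 := hp _ (G.coherentClosure.toSubalgebra.mul_mem hJ hA)
  have h3 := hp _ G.coherentClosure.toSubalgebra.one_mem
  have h4 := hp _ hA
  simp only [adjMatrix_mul_apply, mul_adjMatrix_apply, allOnes, of_apply, Finset.sum_const,
    card_neighborFinset_eq_degree, nsmul_eq_mul, mul_one, Nat.cast_inj] at h1 h2
  rw [Matrix.one_apply, Matrix.one_apply] at h3
  rw [adjMatrix_apply, adjMatrix_apply] at h4
  simp only [pairType, Prod.mk.injEq, decide_eq_decide]
  refine ⟨h1, h2, ?_, ?_⟩
  · split_ifs at h3 <;> simp_all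
  · split_ifs at h4 <;> simp_all

open Classical in
theorem coherentRank_eq_card_image_cell :
    G.coherentRank = (Finset.univ.image G.coherentClosure.cell).card :=
  rfl

theorem card_pairTypes_le_coherentRank : G.pairTypes.card ≤ G.coherentRank := by
  classical
  rw [coherentRank_eq_card_image_cell]
  exact Finset.univ.card_image_le_of_factorsThrough pairType_factorsThrough_cell

/-- The part of the adjacency matrix that belongs to edges between vertices of the same degree. -/
def sameDegreeAdjMatrix (G : SimpleGraph V) [DecidableRel G.Adj] : Matrix V V ℂ :=
  of fun x y => if G.degree x = G.degree y then G.adjMatrix ℂ x y else 0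

omit [DecidableEq V] in
theorem sum_sameDegreeAdjMatrix (hjoin : ∀ x y, G.degree x ≠ G.degree y → G.Adj x y) (x : V) :
    ∑ z, G.sameDegreeAdjMatrix x z =
      (G.degree x : ℂ) - ∑ z, if G.degree x = G.degree z then 0 else 1 := by
  have : (G.degree x : ℂ) = ∑ z, G.adjMatrix ℂ x z := by
    simp [adjMatrix_apply, ← card_neighborFinset_eq_degree, neighborFinset_eq_filter]
  rw [this, ← Finset.sum_sub_distrib]
  refine Finset.sum_congr rfl fun z _ => ?_
  by_cases h : G.degree x = G.degree z
  · simp [sameDegreeAdjMatrix, h]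
  · simp [sameDegreeAdjMatrix, h, adjMatrix_apply, hjoin x z h]

/-- Between vertices of equal degree, `A²` also counts walks through vertices of another degree. In
a join all of these exist, so their number depends only on the degree and is subtracted as a block
constant; `deg - t` in the witness is `α²`. -/
theorem isBlockCombination_sameDegreeAdjMatrix_mul_self
    (hjoin : ∀ x y, G.degree x ≠ G.degree y → G.Adj x y) {s t : ℝ} {α : V → ℝ}
    (hpos : ∀ x, 0 < α x)
    (hsq : G.adjMatrix ℝ * G.adjMatrix ℝ = s • G.adjMatrix ℝ + t • 1 + vecMulVec α α) :
    IsBlockCombination (fun x => G.degree x) G.sameDegreeAdjMatrix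
      (G.sameDegreeAdjMatrix * G.sameDegreeAdjMatrix) := by
  refine ⟨fun _ => t, fun _ => s, fun i j => if i = j then
    ((i : ℂ) - t) - ∑ z, if i = G.degree z then 0 else 1 else 0, fun x y => ?_⟩
  have hα : ∀ x, α x * α x = G.degree x - t := by
    intro x
    have := congrFun (congrFun hsq x) x
    rw [adjMatrix_mul_self_apply_self] at this
    simp [vecMulVec_apply] at this
    linarith
  by_cases hxy : G.degree x = G.degree y
  · have hαxy : α x = α y := by
      have : α x * α x = α y * α y := by rw [hα, hα, hxy]
      nlinarith [hpos x, hpos y, mul_self_inj_of_nonneg (hpos x).le (hpos y).le]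
    have h1 : (G.adjMatrix ℂ * G.adjMatrix ℂ) x y =
        s * G.adjMatrix ℂ x y + (if x = y then (t : ℂ) else 0) + (G.degree x - t) := by
      have h2 := congrArg (fun r : ℝ => (r : ℂ)) (congrFun (congrFun hsq x) y)
      simp only [Matrix.add_apply, Matrix.smul_apply, vecMulVec_apply, ← hαxy, hα, mul_apply,
        adjMatrix_apply, Matrix.one_apply, smul_eq_mul] at h2 ⊢
      push_cast at h2
      simpa [apply_ite Complex.ofReal] using h2
    have h3 : (G.sameDegreeAdjMatrix * G.sameDegreeAdjMatrix) x y =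
        (G.adjMatrix ℂ * G.adjMatrix ℂ) x y - ∑ z, if G.degree x = G.degree z then 0 else 1 := by
      rw [mul_apply, mul_apply, ← Finset.sum_sub_distrib]
      refine Finset.sum_congr rfl fun z _ => ?_
      by_cases h : G.degree x = G.degree z
      · simp [sameDegreeAdjMatrix, h, h.symm.trans hxy]
      · have h' : G.degree z ≠ G.degree y := fun e => h (hxy.trans e.symm)
        simp [sameDegreeAdjMatrix, h, adjMatrix_apply, hjoin x z h, hjoin z y h']
    beta_reduce
    rw [h3, h1, if_pos hxy]
    simp only [sameDegreeAdjMatrix, of_apply, if_pos hxy]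
    ring
  · have hne : x ≠ y := fun h => hxy (h ▸ rfl)
    have h3 : (G.sameDegreeAdjMatrix * G.sameDegreeAdjMatrix) x y = 0 := by
      rw [mul_apply]
      refine Finset.sum_eq_zero fun z _ => ?_
      by_cases h : G.degree x = G.degree z
      · simp [sameDegreeAdjMatrix, h ▸ hxy]
      · simp [sameDegreeAdjMatrix, h]
    rw [h3]
    simp [sameDegreeAdjMatrix, hxy, hne]

/-- If vertices of different degrees are always adjacent, then the relations of the coherent closure
are given by the pair types. -/
theorem coherentRank_le_card_pairTypes
    (hjoin : ∀ x y, G.degree x ≠ G.degree y → G.Adj x y) {s t : ℝ} {α : V → ℝ}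
    (hpos : ∀ x, 0 < α x)
    (hsq : G.adjMatrix ℝ * G.adjMatrix ℝ = s • G.adjMatrix ℝ + t • 1 + vecMulVec α α) :
    G.coherentRank ≤ G.pairTypes.card := by
  classical
  let A : CoherentAlgebra V := ofBlockCombinations (fun x => G.degree x) G.sameDegreeAdjMatrix
    (fun x y => by simp [sameDegreeAdjMatrix, eq_comm, adjMatrix_apply, adj_comm])
    (fun x y => by simp only [sameDegreeAdjMatrix, of_apply, adjMatrix_apply]; split_ifs <;> simp)
    (fun x => by simp [sameDegreeAdjMatrix])
    (fun x y h => if_neg h)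
    (fun i => (i : ℂ) - ∑ z, if i = G.degree z then 0 else 1)
    (sum_sameDegreeAdjMatrix hjoin)
    (isBlockCombination_sameDegreeAdjMatrix_mul_self hjoin hpos hsq)
  have hA : G.adjMatrix ℂ ∈ A.toSubalgebra := by
    refine ⟨0, 1, fun i j => if i = j then 0 else 1, fun x y => ?_⟩
    by_cases h : G.degree x = G.degree y
    · simp [sameDegreeAdjMatrix, h]
    · simp [sameDegreeAdjMatrix, h, adjMatrix_apply, hjoin x y h]
  -- The closure lies inside `A`, and the entries of a block combination depend only on the pair
  -- type.
  have hfac : G.coherentClosure.cell.FactorsThrough G.pairType := by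
    intro p q hpq
    refine G.coherentClosure.cell_eq_of_mem fun M hM => ?_
    obtain ⟨u, v, r, hr⟩ := G.coherentClosure_le A hA hM
    simp only [pairType, Prod.mk.injEq, decide_eq_decide] at hpq
    obtain ⟨h1, h2, h3, h4⟩ := hpq
    simp only [hr, sameDegreeAdjMatrix, of_apply, adjMatrix_apply, h1, h2, h3, h4]
  rw [coherentRank_eq_card_image_cell]
  exact Finset.univ.card_image_le_of_factorsThrough hfac

end SimpleGraph

/-! ### Common neighbours and the quadratic identity. -/

namespace SimpleGraph

variable {V : Type*} [Fintype V] [DecidableEq V] {G : SimpleGraph V} [DecidableRel G.Adj]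

theorem adjMatrix_mul_self_apply (x y : V) :
    (G.adjMatrix ℝ * G.adjMatrix ℝ) x y =
      ((G.neighborFinset x ∩ G.neighborFinset y).card : ℝ) := by
  rw [adjMatrix_mul_apply, Finset.card_eq_sum_ones, ← Finset.filter_mem_eq_inter,
    Finset.sum_filter]
  push_cast
  refine Finset.sum_congr rfl fun z _ => ?_
  simp [adjMatrix_apply, adj_comm]

/-- The identity `A² = sA + tI + ααᵀ` for the adjacency matrix, with a positive vector `α`, in terms
of common neighbours. -/
structure HasWeights (G : SimpleGraph V) [DecidableRel G.Adj] (s t : ℝ) (α : V → ℝ) : Prop where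
  pos : ∀ x, 0 < α x
  card_inter : ∀ x y, ((G.neighborFinset x ∩ G.neighborFinset y).card : ℝ) =
    s * (if G.Adj x y then 1 else 0) + t * (if x = y then 1 else 0) + α x * α y

theorem hasWeights_of_adjMatrix_mul_self {s t : ℝ} {α : V → ℝ} (hpos : ∀ x, 0 < α x)
    (hsq : G.adjMatrix ℝ * G.adjMatrix ℝ = s • G.adjMatrix ℝ + t • 1 + vecMulVec α α) :
    G.HasWeights s t α where
  pos := hpos
  card_inter x y := by
    rw [← adjMatrix_mul_self_apply, hsq]
    simp [vecMulVec_apply, adjMatrix_apply, Matrix.one_apply]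

namespace HasWeights

variable {s t : ℝ} {α : V → ℝ} (h : G.HasWeights s t α)
include h

theorem degree_eq (x : V) : (G.degree x : ℝ) = t + α x * α x := by
  simpa using h.card_inter x x

theorem degree_eq_degree_iff {x y : V} : G.degree x = G.degree y ↔ α x = α y := by
  rw [← Nat.cast_inj (R := ℝ), h.degree_eq, h.degree_eq, add_right_inj,
    mul_self_inj_of_nonneg (h.pos x).le (h.pos y).le]

theorem degree_eq_of_mul_eq {x y : V} (hxy : α x * α y = α x * α x) :
    G.degree x = G.degree y :=
  h.degree_eq_degree_iff.2 (mul_left_cancel₀ (h.pos x).ne' hxy).symm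

omit h in
theorem card_inter_of_forall_adj {x y : V} (hx : ∀ z, z ≠ x → G.Adj x z) (hxy : x ≠ y) :
    ((G.neighborFinset x ∩ G.neighborFinset y).card : ℝ) = G.degree y - 1 := by
  have : G.neighborFinset x ∩ G.neighborFinset y = (G.neighborFinset y).erase x := by
    ext z
    simp only [Finset.mem_inter, mem_neighborFinset, Finset.mem_erase]
    exact ⟨fun hz => ⟨hz.1.ne', hz.2⟩, fun hz => ⟨hx z hz.1, hz.2⟩⟩
  have hmem : x ∈ G.neighborFinset y := by simpa using (hx y hxy.symm).symm
  rw [this, ← card_neighborFinset_eq_degree, ← Finset.card_erase_add_one hmem]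
  simp

/-- A graph with two dominating vertices is regular. -/
theorem degree_eq_of_forall_adj {x x' : V} (hx : ∀ z, z ≠ x → G.Adj x z)
    (hx' : ∀ z, z ≠ x' → G.Adj x' z) (hne : x ≠ x') (y : V) : G.degree y = G.degree x := by
  by_cases hxy : x = y
  · rw [hxy]
  -- Removing each of the two vertices from the other's neighbourhood leaves the same set.
  have hd : G.degree x = G.degree x' := by
    rw [← card_neighborFinset_eq_degree, ← card_neighborFinset_eq_degree,
      ← Finset.card_erase_add_one (s := G.neighborFinset x) (a := x') (by simpa using hx _ hne.symm),
      ← Finset.card_erase_add_one (s := G.neighborFinset x') (a := x) (by simpa using hx' _ hne)]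
    congr 2
    ext z
    simp only [Finset.mem_erase, mem_neighborFinset]
    exact ⟨fun hz => ⟨hz.2.ne', hx' z hz.1⟩, fun hz => ⟨hz.2.ne', hx z hz.1⟩⟩
  have h1 := h.card_inter x x'
  have h2 := h.card_inter x y
  rw [card_inter_of_forall_adj hx hne, ← hd, if_pos (hx _ hne.symm), if_neg hne,
    ← h.degree_eq_degree_iff.1 hd] at h1
  rw [card_inter_of_forall_adj hx hxy, if_pos (hx _ (Ne.symm hxy)), if_neg hxy] at h2
  -- Subtracting the two counts gives `deg y - deg x = α x (α y - α x)`, while the left side is also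
  -- `α y² - α x²`.
  refine h.degree_eq_of_mul_eq ?_
  linarith [h.degree_eq x, h.degree_eq y]

omit h in
theorem degree_add_degree_of_forall_adj_or {x y : V} (hxy : ∀ z, G.Adj x z ∨ G.Adj y z) :
    (G.degree x + G.degree y : ℝ) =
      Fintype.card V + ((G.neighborFinset x ∩ G.neighborFinset y).card : ℝ) := by
  have hu : G.neighborFinset x ∪ G.neighborFinset y = Finset.univ := by
    ext z; simpa using hxy z
  have := Finset.card_union_add_card_inter (G.neighborFinset x) (G.neighborFinset y)
  rw [hu, Finset.card_univ, card_neighborFinset_eq_degree, card_neighborFinset_eq_degree] at this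
  exact_mod_cast this.symm

/-- A join of an edgeless graph on at least two vertices and a regular graph with an edge cannot
have two different degrees. -/
theorem degree_eq_of_forall_adj_iff {x x' y y' : V}
    (hx : ∀ u z, G.degree u = G.degree x → (G.Adj u z ↔ G.degree z ≠ G.degree x))
    (hne : x ≠ x') (hd : G.degree x' = G.degree x) (hyy' : G.Adj y y')
    (hdy : G.degree y = G.degree y') (hy : ∀ z, G.degree z = G.degree x ∨ G.degree z = G.degree y) :
    G.degree x = G.degree y := by
  by_contra hxy
  have hxx' : ¬ G.Adj x x' := fun hadj => (hx x x' rfl).1 hadj hd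
  -- `x` and `x'` are nonadjacent with the same neighbourhood, so `deg x = α x²`.
  have ht : t = 0 := by
    have h1 := h.card_inter x x'
    have hN : G.neighborFinset x ∩ G.neighborFinset x' = G.neighborFinset x := by
      ext z
      simp [hx x z rfl, hx x' z hd]
    rw [hN, if_neg hxx', if_neg hne, card_neighborFinset_eq_degree, h.degree_eq,
      h.degree_eq_degree_iff.1 hd] at h1
    linarith
  have hadj : ∀ z, G.Adj x z ∨ G.Adj y z := by
    intro z
    rcases hy z with hz | hz
    · exact Or.inr ((hx z y hz).2 (Ne.symm hxy)).symm
    · exact Or.inl ((hx x z rfl).2 fun e => hxy (e.symm.trans hz))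
  have hadj' : ∀ z, G.Adj y z ∨ G.Adj y' z := by
    intro z
    rcases hy z with hz | hz
    · exact Or.inl ((hx z y hz).2 (Ne.symm hxy)).symm
    · by_cases hyz : G.Adj y z
      · exact Or.inl hyz
      right
      by_cases hzy : z = y
      · exact hzy ▸ hyy'.symm
      -- With `t = 0`, nonadjacent `y` and `z` of equal degree have `α y² = deg y` common
      -- neighbours, so `N(y) ⊆ N(z)` and `z` is adjacent to `y'`.
      have h1 := h.card_inter y z
      rw [if_neg hyz, if_neg (Ne.symm hzy), h.degree_eq_degree_iff.1 hz, mul_zero, mul_zero,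
        zero_add, zero_add, ← zero_add (α y * α y), ← ht, ← h.degree_eq, Nat.cast_inj,
        ← card_neighborFinset_eq_degree] at h1
      have h2 := Finset.eq_of_subset_of_card_le Finset.inter_subset_left h1.ge
      have h3 : y' ∈ G.neighborFinset y ∩ G.neighborFinset z := by rw [h2]; simpa using hyy'
      simp only [Finset.mem_inter, mem_neighborFinset] at h3
      exact h3.2.symm
  have e1 := degree_add_degree_of_forall_adj_or hadj
  have e2 := degree_add_degree_of_forall_adj_or hadj'
  have hxadj : G.Adj x y := (hx x y rfl).2 (Ne.symm hxy)
  rw [h.card_inter, if_pos hxadj, if_neg hxadj.ne, h.degree_eq, h.degree_eq y] at e1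
  rw [h.card_inter, if_pos hyy', if_neg hyy'.ne, ← hdy, h.degree_eq,
    ← h.degree_eq_degree_iff.1 hdy] at e2
  -- Subtracting the inclusion–exclusion counts for the edges `xy` and `yy'` cancels `s` and `|V|`,
  -- leaving `α x² = α x α y`.
  exact hxy (h.degree_eq_of_mul_eq (by linarith))

/-- In a connected graph with two degrees, every vertex has a neighbour of the other degree. -/
theorem exists_adj_degree_ne (hconn : G.Connected) {θ : ℝ} (hθ : G.adjMatrix ℝ *ᵥ α = θ • α)
    {x y : V} (hxy : G.degree x ≠ G.degree y)
    (hdeg : ∀ z, G.degree z = G.degree x ∨ G.degree z = G.degree y) :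
    ∃ z, G.Adj x z ∧ G.degree z = G.degree y := by
  by_contra! hno
  have hsum : ∀ u, ∑ z ∈ G.neighborFinset u, α z = θ * α u := fun u => by
    simpa [adjMatrix_mulVec_apply] using congrFun hθ u
  have hθx : θ = G.degree x := by
    have h1 : ∑ z ∈ G.neighborFinset x, α z = ∑ z ∈ G.neighborFinset x, α x := by
      refine Finset.sum_congr rfl fun z hz => h.degree_eq_degree_iff.1 ?_
      exact (hdeg z).resolve_right (hno z (by simpa using hz))
    rw [hsum, Finset.sum_const, card_neighborFinset_eq_degree, nsmul_eq_mul] at h1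
    exact mul_right_cancel₀ (h.pos x).ne' h1
  have hne : α y - α x ≠ 0 := sub_ne_zero.2 fun e => hxy (h.degree_eq_degree_iff.2 e.symm)
  -- Since `θ = deg x`, the differences `α z - α u` over the neighbours `z` of `u` sum to 0. Each is
  -- 0 or the fixed nonzero `α y - α x`, so no neighbour has the other degree.
  have step : ∀ u v, G.Adj u v → G.degree u = G.degree x → G.degree v = G.degree x := by
    intro u v huv hu
    refine (hdeg v).resolve_right fun hv => ?_
    have hαu := h.degree_eq_degree_iff.1 hu
    have h1 : ∑ z ∈ G.neighborFinset u, (α z - α u) =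
        ∑ z ∈ G.neighborFinset u, if G.degree z = G.degree y then α y - α x else 0 := by
      refine Finset.sum_congr rfl fun z _ => ?_
      split_ifs with hz
      · rw [h.degree_eq_degree_iff.1 hz, hαu]
      · rw [h.degree_eq_degree_iff.1 ((hdeg z).resolve_right hz), hαu, sub_self]
    rw [Finset.sum_sub_distrib, hsum, Finset.sum_const, card_neighborFinset_eq_degree, hθx, hu,
      nsmul_eq_mul, sub_self, ← Finset.sum_filter, Finset.sum_const, nsmul_eq_mul] at h1
    have h2 := (mul_eq_zero.1 h1.symm).resolve_right hne
    rw [Nat.cast_eq_zero, Finset.card_eq_zero] at h2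
    exact Finset.notMem_empty v (h2 ▸ by simpa using ⟨huv, hv⟩)
  have hall : ∀ u v, G.Walk u v → G.degree u = G.degree x → G.degree v = G.degree x := by
    intro u v w
    induction w with
    | nil => exact id
    | cons hadj _ ih => exact fun hu => ih (step _ _ hadj hu)
  obtain ⟨w⟩ := hconn.preconnected x y
  exact hxy (hall x y w rfl).symm

end HasWeights

end SimpleGraph

/-! ### Counting pair types. -/

namespace SimpleGraph

variable {V : Type*} [Fintype V] [DecidableEq V] {G : SimpleGraph V} [DecidableRel G.Adj]

theorem mem_pairTypes {q : ℕ × ℕ × Bool × Bool} :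
    q ∈ G.pairTypes ↔ ∃ x y, G.pairType (x, y) = q := by
  simp [pairTypes]

theorem mem_pairTypes_of_adj {x y : V} (hxy : G.Adj x y) :
    (G.degree x, G.degree y, false, true) ∈ G.pairTypes :=
  mem_pairTypes.2 ⟨x, y, by simp [pairType, hxy, hxy.ne]⟩

theorem mem_pairTypes_of_not_adj {x y : V} (hne : x ≠ y) (hxy : ¬ G.Adj x y) :
    (G.degree x, G.degree y, false, false) ∈ G.pairTypes :=
  mem_pairTypes.2 ⟨x, y, by simp [pairType, hxy, hne]⟩

theorem mem_pairTypes_self (x : V) : (G.degree x, G.degree x, true, false) ∈ G.pairTypes :=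
  mem_pairTypes.2 ⟨x, x, by simp [pairType]⟩

theorem exists_adj_of_mem_pairTypes {d e : ℕ} (h : (d, e, false, true) ∈ G.pairTypes) :
    ∃ x y, G.degree x = d ∧ G.degree y = e ∧ x ≠ y ∧ G.Adj x y := by
  obtain ⟨x, y, h⟩ := mem_pairTypes.1 h
  exact ⟨x, y, by simpa [pairType] using h⟩

theorem exists_not_adj_of_mem_pairTypes {d e : ℕ} (h : (d, e, false, false) ∈ G.pairTypes) :
    ∃ x y, G.degree x = d ∧ G.degree y = e ∧ x ≠ y ∧ ¬ G.Adj x y := by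
  obtain ⟨x, y, h⟩ := mem_pairTypes.1 h
  exact ⟨x, y, by simpa [pairType] using h⟩

theorem sq_card_degrees_le_card_pairTypes :
    (Finset.univ.image fun x => G.degree x).card ^ 2 ≤ G.pairTypes.card := by
  rw [sq, ← Finset.card_product]
  refine le_trans (Finset.card_le_card ?_)
    (Finset.card_image_le (s := G.pairTypes) (f := fun q => (q.1, q.2.1)))
  rintro ⟨d, e⟩ hde
  simp only [Finset.mem_product, Finset.mem_image, Finset.mem_univ, true_and] at hde
  obtain ⟨⟨x, rfl⟩, y, rfl⟩ := hde
  exact Finset.mem_image.2 ⟨_, pairType_mem x y, rfl⟩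

theorem card_pairTypes_le_three {d : ℕ} (hd : ∀ x, G.degree x = d) : G.pairTypes.card ≤ 3 := by
  refine (Finset.card_le_card (t := {(d, d, true, false), (d, d, false, true),
    (d, d, false, false)}) ?_).trans Finset.card_le_three
  intro q hq
  obtain ⟨x, y, rfl⟩ := mem_pairTypes.1 hq
  by_cases hxy : x = y
  · subst hxy; simp [pairType, hd]
  · by_cases hadj : G.Adj x y <;> simp [pairType, hd, hxy, hadj]

theorem pairTypes_subset_of_join (hjoin : ∀ x y, G.degree x ≠ G.degree y → G.Adj x y) {d e : ℕ}
    (hdeg : ∀ z, G.degree z = d ∨ G.degree z = e) :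
    G.pairTypes ⊆ {(d, d, true, false), (d, d, false, true), (d, d, false, false),
      (e, e, true, false), (e, e, false, true), (e, e, false, false),
      (d, e, false, true), (e, d, false, true)} := by
  intro q hq
  obtain ⟨x, y, rfl⟩ := mem_pairTypes.1 hq
  by_cases hxy : x = y
  · subst hxy
    rcases hdeg x with h | h <;> simp [pairType, h]
  · by_cases hde : G.degree x = G.degree y
    · rcases hdeg y with h | h <;> by_cases hadj : G.Adj x y <;>
        simp [pairType, hde, h, hxy, hadj]
    · have hadj := hjoin x y hde
      rcases hdeg x with h | h <;> rcases hdeg y with h' | h' <;>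
        simp [pairType, h, h', hxy, hadj]

namespace HasWeights

variable {s t : ℝ} {α : V → ℝ} (h : G.HasWeights s t α)
include h

/-- If the graph is a join of two regular graphs of different degrees, and all pair types inside the
two parts occur up to one exception, then the exception does not lie in the first part. -/
theorem mem_pairTypes_of_join (hjoin : ∀ x y, G.degree x ≠ G.degree y → G.Adj x y) {d e : ℕ}
    (hne : d ≠ e) (hdeg : ∀ z, G.degree z = d ∨ G.degree z = e)
    (h1 : (d, d, false, true) ∈ G.pairTypes ∨ (d, d, false, false) ∈ G.pairTypes)
    (h2 : (d, d, false, true) ∈ G.pairTypes ∨ (e, e, false, true) ∈ G.pairTypes)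
    (he : ∃ y, G.degree y = e) :
    (d, d, false, true) ∈ G.pairTypes ∧ (d, d, false, false) ∈ G.pairTypes := by
  -- Otherwise part `d` is edgeless with at least two vertices, and part `e` contains an edge.
  have hedge : (d, d, false, true) ∈ G.pairTypes := by
    by_contra hno
    obtain ⟨x, x', hx, hx', hxx', -⟩ := exists_not_adj_of_mem_pairTypes (h1.resolve_left hno)
    obtain ⟨y, y', hy, hy', -, hyy'⟩ := exists_adj_of_mem_pairTypes (h2.resolve_left hno)
    refine hne (hx ▸ hy ▸ h.degree_eq_of_forall_adj_iff (x := x) (x' := x') (y := y) (y' := y') ?_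
      hxx' (hx'.trans hx.symm) hyy' (hy.trans hy'.symm) fun z => hx ▸ hy ▸ hdeg z)
    intro u z hu
    refine ⟨fun hadj hz => hno ?_, fun hz => hjoin u z fun e => hz (e.symm.trans hu)⟩
    have := mem_pairTypes_of_adj hadj
    rwa [hu, hz, hx] at this
  refine ⟨hedge, ?_⟩
  -- Without a non-edge, the ends of an edge inside part `d` are two dominating vertices, so the
  -- graph is regular.
  by_contra hno
  obtain ⟨x, x', hx, hx', hxx', -⟩ := exists_adj_of_mem_pairTypes hedge
  obtain ⟨y, hy⟩ := he
  have hdom : ∀ u, G.degree u = d → ∀ z, z ≠ u → G.Adj u z := by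
    intro u hu z hz
    by_contra hadj
    by_cases hd : G.degree u = G.degree z
    · have := mem_pairTypes_of_not_adj hz.symm hadj
      rw [← hd, hu] at this
      exact hno this
    · exact hadj (hjoin u z hd)
  exact hne (hx ▸ hy ▸ (h.degree_eq_of_forall_adj (hdom x hx) (hdom x' hx') hxx' y).symm)

theorem card_pairTypes_ne_seven_of_join (hjoin : ∀ x y, G.degree x ≠ G.degree y → G.Adj x y)
    {x y : V} (hxy : G.degree x ≠ G.degree y)
    (hdeg : ∀ z, G.degree z = G.degree x ∨ G.degree z = G.degree y) :
    G.pairTypes.card ≠ 7 := by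
  intro h7
  have hsub := pairTypes_subset_of_join hjoin hdeg
  set d := G.degree x with hd
  set e := G.degree y with he
  set F : Finset (ℕ × ℕ × Bool × Bool) := {(d, d, true, false), (d, d, false, true),
    (d, d, false, false), (e, e, true, false), (e, e, false, true), (e, e, false, false),
    (d, e, false, true), (e, d, false, true)} with hF
  have hF8 : F.card = 8 := by
    rw [hF]
    simp [Finset.card_insert_of_notMem, hxy, hxy.symm]
  have hmiss : (F \ G.pairTypes).card = 1 := by
    rw [Finset.card_sdiff_of_subset hsub, hF8, h7]
  have htwo : ∀ q ∈ F, ∀ q' ∈ F, q ≠ q' → q ∈ G.pairTypes ∨ q' ∈ G.pairTypes := by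
    intro q hq q' hq' hne
    by_contra! hno
    exact hne (Finset.card_le_one.1 hmiss.le q (Finset.mem_sdiff.2 ⟨hq, hno.1⟩) q'
      (Finset.mem_sdiff.2 ⟨hq', hno.2⟩))
  have hd' := h.mem_pairTypes_of_join hjoin hxy hdeg
    (htwo _ (by simp [hF]) _ (by simp [hF]) (by simp))
    (htwo _ (by simp [hF]) _ (by simp [hF]) (by simp [hxy])) ⟨y, rfl⟩
  have he' := h.mem_pairTypes_of_join hjoin hxy.symm (fun z => (hdeg z).symm)
    (htwo _ (by simp [hF]) _ (by simp [hF]) (by simp))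
    (htwo _ (by simp [hF]) _ (by simp [hF]) (by simp [hxy.symm])) ⟨x, rfl⟩
  have hFsub : F ⊆ G.pairTypes := by
    have hadj := hjoin x y hxy
    intro q hq
    simp only [hF, Finset.mem_insert, Finset.mem_singleton] at hq
    rcases hq with rfl | rfl | rfl | rfl | rfl | rfl | rfl | rfl
    exacts [mem_pairTypes_self x, hd'.1, hd'.2, mem_pairTypes_self y, he'.1, he'.2,
      mem_pairTypes_of_adj hadj, mem_pairTypes_of_adj hadj.symm]
  have := Finset.card_le_card hFsub
  omega

/-- Adjacent and nonadjacent pairs both occur across the degrees, in both orders: four types. The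
diagonal gives two. A neighbour of `y` of the degree of `x` differs from `x`, and symmetrically, so
each degree class also has an off-diagonal type. -/
theorem eight_le_card_pairTypes (hconn : G.Connected) {θ : ℝ} (hθ : G.adjMatrix ℝ *ᵥ α = θ • α)
    {x y : V} (hxy : G.degree x ≠ G.degree y) (hadj : ¬ G.Adj x y)
    (hdeg : ∀ z, G.degree z = G.degree x ∨ G.degree z = G.degree y) :
    8 ≤ G.pairTypes.card := by
  obtain ⟨y', hxy', hy'⟩ := h.exists_adj_degree_ne hconn hθ hxy hdeg
  obtain ⟨x', hyx', hx'⟩ := h.exists_adj_degree_ne hconn hθ hxy.symm fun z => (hdeg z).symm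
  have hxx' : x ≠ x' := by rintro rfl; exact hadj hyx'.symm
  have hyy' : y ≠ y' := by rintro rfl; exact hadj hxy'
  have hne : x ≠ y := fun e => hxy (e ▸ rfl)
  have hinner : ∀ u v : V, u ≠ v → G.degree v = G.degree u →
      ∃ b, (G.degree u, G.degree u, false, b) ∈ G.pairTypes := by
    intro u v huv hd
    by_cases huv' : G.Adj u v
    · have := mem_pairTypes_of_adj huv'
      exact ⟨_, hd ▸ this⟩
    · have := mem_pairTypes_of_not_adj huv huv'
      exact ⟨_, hd ▸ this⟩
  obtain ⟨b, hb⟩ := hinner x x' hxx' hx'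
  obtain ⟨c, hc⟩ := hinner y y' hyy' hy'
  have m1 := mem_pairTypes_of_adj hxy'
  have m2 := mem_pairTypes_of_adj hxy'.symm
  rw [hy'] at m1 m2
  have m3 := mem_pairTypes_of_not_adj hne hadj
  have m4 := mem_pairTypes_of_not_adj hne.symm fun e => hadj e.symm
  have m5 := mem_pairTypes_self (G := G) x
  have m6 := mem_pairTypes_self (G := G) y
  set d := G.degree x
  set e := G.degree y
  have hcard : ({(d, d, true, false), (d, d, false, b), (e, e, true, false), (e, e, false, c),
      (d, e, false, true), (d, e, false, false), (e, d, false, true), (e, d, false, false)} :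
      Finset (ℕ × ℕ × Bool × Bool)).card = 8 := by
    simp [Finset.card_insert_of_notMem, hxy, hxy.symm]
  rw [← hcard]
  refine Finset.card_le_card fun q hq => ?_
  simp only [Finset.mem_insert, Finset.mem_singleton] at hq
  rcases hq with rfl | rfl | rfl | rfl | rfl | rfl | rfl | rfl <;> assumption

end HasWeights

end SimpleGraph

/-! ### Conclusion by the number of degrees. -/

open SimpleGraph in
theorem theorem3p5 {V : Type*} [Fintype V] [DecidableEq V] (G : SimpleGraph V) [DecidableRel G.Adj]
    (hconn : G.Connected) (heig : G.eigenvalueSet.ncard = 3) :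
    G.coherentRank ≠ 7 := by
  intro h7
  obtain ⟨s, t, θ, α, hpos, hθ, hsq⟩ := hconn.exists_adjMatrix_mul_self_eq heig
  have h := hasWeights_of_adjMatrix_mul_self hpos hsq
  have hle := G.card_pairTypes_le_coherentRank
  by_cases hreg : ∀ x y, G.degree x = G.degree y
  · obtain ⟨o⟩ := hconn.nonempty
    -- A regular graph satisfies the join condition vacuously.
    have h1 := coherentRank_le_card_pairTypes (fun x y hxy => (hxy (hreg x y)).elim) hpos hsq
    have h2 := card_pairTypes_le_three fun x => hreg x o
    omega
  push Not at hreg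
  obtain ⟨x, y, hxy⟩ := hreg
  by_cases hdeg : ∀ z, G.degree z = G.degree x ∨ G.degree z = G.degree y
  · by_cases hjoin : ∀ x y, G.degree x ≠ G.degree y → G.Adj x y
    · have h1 := coherentRank_le_card_pairTypes hjoin hpos hsq
      exact h.card_pairTypes_ne_seven_of_join hjoin hxy hdeg (by omega)
    · push Not at hjoin
      obtain ⟨u, v, huv, hadj⟩ := hjoin
      have := h.eight_le_card_pairTypes hconn hθ huv hadj fun z => by
        have hu := hdeg u
        have hv := hdeg v
        have hz := hdeg z
        omega
      omega
  · push Not at hdeg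
    obtain ⟨z, hzx, hzy⟩ := hdeg
    have h3 : 3 ≤ (Finset.univ.image fun x => G.degree x).card := by
      rw [← Finset.card_eq_three.2 ⟨_, _, _, hxy, hzx.symm, hzy.symm, rfl⟩]
      refine Finset.card_le_card fun d hd => ?_
      simp only [Finset.mem_insert, Finset.mem_singleton] at hd
      rcases hd with rfl | rfl | rfl <;> simp
    have h9 := G.sq_card_degrees_le_card_pairTypes
    nlinarith
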